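/- Let $\alpha,\beta>0$ and $p\ge 1$. There is a constant $C>0$, depending only on $\alpha,\beta,p$, with the following property. Let $(E,d)$ be a Polish space, let $\mu$ be a Borel probability measure on $E$, and let $S\subset E$ be a bounded set with $\mu(S)=1$ and diameter $\Delta$ which is of finite-dimensional type, in the sense that $$N(S,\delta)\le \beta\left(\frac{\Delta}{\delta}\right)^{\alpha}\qquad\text{for all }\delta\in(0,\Delta],$$ where $N(S,\delta)$ is the minimal number of closed balls of radius $\delta$ with centres in $S$ whose union contains $S$. Let $n\ge 1$, let $X_1,\dots,X_n$ be independent $E$-valued random variables with common distribution $\mu$ on a probability space $(\Omega,\mathcal A,\mathbb P)$, let $L_n=\frac1n\sum_{i=1}^n\delta_{X_i}$ be their empirical measure, and let $$W_p^p(\mu,L_n)=\inf_{\pi}\int d(x,y)^p\,\pi(dx,dy),$$ where the infimum is over all probability measures $\pi$ on $E\times E$ with marginals $\mu$ and $L_n$. Then $W_p^p(\mu,L_n)$ is a random variable (it is $\mathbb P$-almost everywhere measurable) and, for every real $r\ge 2$, its norm $\|W_p^p(\mu,L_n)\|_r=\mathbb E[(W_p^p(\mu,L_n))^r]^{1/r}$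 satisfies $$\|W_p^p(\mu,L_n)\|_r\le \begin{cases} C\,\Delta^p\,\sqrt{\dfrac rn} & \text{if }\alpha<2p,\\[2mm] C\,\Delta^p\,\sqrt{\dfrac rn}\,\log\left(e+\dfrac nr\right) & \text{if }\alpha=2p,\\[2mm] C\,\Delta^p\left(\dfrac rn\right)^{p/\alpha} & \text{if }\alpha>2p.\end{cases}$$ -/

import Mathlib

open MeasureTheory ProbabilityTheory
open scoped ENNReal NNReal

universe u v

noncomputable section

/-- `IsCoupling π μ ν`: `π` is a probability measure on `E × E` with marginals `μ` and `ν`. -/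
def IsCoupling {E : Type*} [MeasurableSpace E] (π : Measure (E × E)) (μ ν : Measure E) : Prop :=
  IsProbabilityMeasure π ∧ π.map Prod.fst = μ ∧ π.map Prod.snd = ν

/-- The `p`-th power `W_p^p(μ, ν)` of the Wasserstein distance: the infimum of `∫ d(x, y)^p dπ`
over all couplings `π` of `μ` and `ν`, as an element of `[0, ∞]`. -/
def wassersteinPow {E : Type*} [MetricSpace E] [MeasurableSpace E] (p : ℝ) (μ ν : Measure E) :
    ℝ≥0∞ :=
  ⨅ (π : Measure (E × E)) (_ : IsCoupling π μ ν), ∫⁻ z, edist z.1 z.2 ^ p ∂π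

/-- The empirical measure `(1 / n) ∑ i, δ_{x i}` of a sample of size `n`. -/
def empiricalMeasure {E : Type*} [MeasurableSpace E] {n : ℕ} (x : Fin n → E) : Measure E :=
  (n : ℝ≥0∞)⁻¹ • ∑ i, Measure.dirac (x i)

/-- `S` is of finite-dimensional type with parameters `α`, `β`: it is bounded, and with
`Δ = diam S`, its covering numbers by closed balls with centres in `S` satisfy
`N(S, δ) ≤ β (Δ / δ) ^ α` for all `δ ∈ (0, Δ]`. -/
def FiniteDimensionalType {E : Type*} [MetricSpace E] (S : Set E) (α β : ℝ) : Prop :=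
  Bornology.IsBounded S ∧
    ∀ δ : ℝ≥0, 0 < δ → (δ : ℝ) ≤ Metric.diam S →
      (Metric.coveringNumber δ S : ℝ≥0∞) ≤ ENNReal.ofReal (β * (Metric.diam S / δ) ^ α)

end

/-! Transport is built greedily along nested partitions of mesh about `Δ / 2 ^ k`: match all
possible mass inside the finest cells and pass the remainder to the next coarser level. The mass
moved at level `k` is at most the total excess `∑ (μ c - L_n c)⁺` over cells of level `k + 1`, and
each unit costs at most a multiple of `Δ ^ p * 2 ^ (-p k)` (`exists_coupling_of_nested_partitions`).

That excess is the value of `μ U - L_n U` at one of the `2 ^ card` unions `U` of cells. Hoeffding's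
bound for each `U`, summed over all of them, bounds its `r`-norm by `4 √(M / n)` whenever `M ≥ r`
and `M ≥ card` (`eLpNorm_sum_tsub_empiricalMeasure_le`). With about `2 ^ (α k)` cells at level `k`,
Minkowski's inequality leaves a geometric sum of ratio `2 ^ (α / 2 - p)`. Its behaviour gives the
three regimes, after a choice of the depth `K` in terms of `r / n`.

Measurability is separate: the cost is an infimum of continuous functions of the sample. -/

/-! ### Measurability of the transport cost in the sample. -/

theorem continuous_lintegral_edist_rpow {E : Type*} [PseudoEMetricSpace E] [MeasurableSpace E]
    [OpensMeasurableSpace E] (ρ : Measure E) [IsFiniteMeasure ρ] {p : ℝ} (hp : 0 ≤ p)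
    {a : E} {R : ℝ≥0∞} (hR : R ≠ ∞) (hb : ∀ᵐ z ∂ρ, edist z a ≤ R)
    (hfin : ∀ x : E, edist a x ≠ ∞) :
    Continuous fun x => ∫⁻ z, edist z x ^ p ∂ρ := by
  rw [continuous_iff_continuousAt]
  intro x
  refine tendsto_lintegral_filter_of_dominated_convergence
    (fun _ => (R + edist a x + 1) ^ p) ?_ ?_ ?_ ?_
  · exact Filter.Eventually.of_forall fun y => measurable_edist_left.pow_const p
  · filter_upwards [Metric.eball_mem_nhds x one_pos] with y hy
    filter_upwards [hb] with z hz
    refine ENNReal.rpow_le_rpow ?_ hp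
    calc edist z y ≤ edist z a + edist a x + edist x y := edist_triangle4 _ _ _ _
      _ ≤ R + edist a x + 1 := by
        rw [edist_comm x y]
        gcongr
        exact (Metric.mem_eball.1 hy).le
  · rw [lintegral_const]
    refine ENNReal.mul_ne_top (ENNReal.rpow_ne_top_of_nonneg hp ?_) (measure_ne_top _ _)
    exact ENNReal.add_ne_top.2 ⟨ENNReal.add_ne_top.2 ⟨hR, hfin x⟩, ENNReal.one_ne_top⟩
  · refine Filter.Eventually.of_forall fun z => ?_
    exact (ENNReal.continuous_rpow_const.comp (continuous_const.edist continuous_id)).tendsto x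

theorem lintegral_empiricalMeasure {E : Type*} [MeasurableSpace E] {n : ℕ} (x : Fin n → E)
    {g : E → ℝ≥0∞} (hg : Measurable g) :
    ∫⁻ z, g z ∂(empiricalMeasure x) = (n : ℝ≥0∞)⁻¹ * ∑ i, g (x i) := by
  rw [empiricalMeasure, lintegral_smul_measure, lintegral_finsetSum_measure]
  simp [lintegral_dirac' _ hg]

theorem empiricalMeasure_apply {E : Type*} [MeasurableSpace E] {n : ℕ} (x : Fin n → E)
    {s : Set E} (hs : MeasurableSet s) :
    empiricalMeasure x s = (n : ℝ≥0∞)⁻¹ * ∑ i, s.indicator 1 (x i) := by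
  simp [empiricalMeasure, Measure.dirac_apply' _ hs]

theorem isProbabilityMeasure_empiricalMeasure {E : Type*} [MeasurableSpace E] {n : ℕ} (hn : n ≠ 0)
    (x : Fin n → E) : IsProbabilityMeasure (empiricalMeasure x) := by
  refine ⟨?_⟩
  rw [empiricalMeasure_apply x MeasurableSet.univ]
  simp [ENNReal.inv_mul_cancel, hn]

/-- A transport plan from `μ` to an empirical measure is a decomposition of `μ` into `n` pieces
of mass `1 / n`. -/
theorem wassersteinPow_empiricalMeasure {E : Type*} [MetricSpace E] [PolishSpace E]
    [MeasurableSpace E] [BorelSpace E] (p : ℝ) (μ : Measure E) [IsProbabilityMeasure μ]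
    {n : ℕ} (x : Fin n → E) :
    wassersteinPow p μ (empiricalMeasure x) =
      ⨅ (ρ : Fin n → Measure E) (_ : ∑ i, ρ i = μ ∧ ∀ i, ρ i Set.univ = (n : ℝ≥0∞)⁻¹),
        ∑ i, ∫⁻ z, edist z (x i) ^ p ∂(ρ i) := by
  have hmeas : Measurable fun z : E × E => edist z.1 z.2 ^ p := measurable_edist.pow_const p
  refine le_antisymm (le_iInf₂ fun ρ hρ => ?_) (le_iInf₂ fun π hπ => ?_)
  · obtain ⟨hsum, hmass⟩ := hρ
    have hm : ∀ i, Measurable fun z : E => (z, x i) := fun i => measurable_id.prodMk measurable_const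
    set π : Measure (E × E) := ∑ i, (ρ i).map fun z => (z, x i) with hπ
    have hfst : π.map Prod.fst = μ := by
      rw [hπ, Measure.map_finset_sum measurable_fst.aemeasurable, ← hsum]
      refine Finset.sum_congr rfl fun i _ => ?_
      rw [Measure.map_map measurable_fst (hm i)]
      exact Measure.map_id
    have hsnd : π.map Prod.snd = empiricalMeasure x := by
      rw [hπ, Measure.map_finset_sum measurable_snd.aemeasurable, empiricalMeasure,
        Finset.smul_sum]
      refine Finset.sum_congr rfl fun i _ => ?_
      rw [Measure.map_map measurable_snd (hm i), ← hmass i]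
      exact Measure.map_const _ _
    refine (iInf₂_le π ⟨⟨?_⟩, hfst, hsnd⟩).trans_eq ?_
    · rw [hπ, lintegral_finsetSum_measure]
      refine Finset.sum_congr rfl fun i _ => ?_
      rw [lintegral_map hmeas (hm i)]
    · have := congrArg (fun m => m Set.univ) hfst
      simpa [Measure.map_apply measurable_fst MeasurableSet.univ] using this
  · obtain ⟨hprob, hfst, hsnd⟩ := hπ
    classical
    -- Sample points may coincide: `N` counts multiplicity, and `h i` gives index `i` an equal share
    -- of the atom at `x i`.
    let N : E → ℝ≥0∞ := fun y => ∑ j, ({x j} : Set E).indicator 1 y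
    have hN : Measurable N := Finset.measurable_sum _ fun j _ =>
      measurable_one.indicator (measurableSet_singleton _)
    let h : Fin n → E → ℝ≥0∞ := fun i y => ({x i} : Set E).indicator 1 y * (N y)⁻¹
    have hh : ∀ i, Measurable (h i) := fun i =>
      (measurable_one.indicator (measurableSet_singleton _)).mul hN.inv
    have hNtop : ∀ y, N y ≠ ∞ := fun y => by
      refine (ENNReal.sum_lt_top.2 fun j _ => ?_).ne
      by_cases hy : y ∈ ({x j} : Set E) <;> simp [hy]
    have hN0 : ∀ i, N (x i) ≠ 0 := fun i h0 => by
      have := (Finset.sum_eq_zero_iff.1 h0) i (Finset.mem_univ i)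
      simp at this
    have hone : ∀ᵐ z ∂π, ∑ i, h i z.2 = 1 := by
      have hae : ∀ᵐ y ∂(empiricalMeasure x), ∑ i, h i y = 1 := by
        have hset : MeasurableSet {y | ¬ ∑ i, h i y = 1} :=
          (measurableSet_eq_fun (Finset.measurable_sum _ fun i _ => hh i)
            measurable_const).compl
        rw [ae_iff, empiricalMeasure_apply x hset]
        refine mul_eq_zero_of_right _ (Finset.sum_eq_zero fun i _ => ?_)
        refine Set.indicator_of_notMem ?_ _
        simp only [Set.mem_ofPred_eq, not_not, h]
        rw [← Finset.sum_mul]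
        exact ENNReal.mul_inv_cancel (hN0 i) (hNtop _)
      rw [← hsnd] at hae
      exact ae_of_ae_map measurable_snd.aemeasurable hae
    let ρ : Fin n → Measure E := fun i => (π.withDensity fun z => h i z.2).map Prod.fst
    have hh2 : ∀ i, Measurable fun z : E × E => h i z.2 := fun i => (hh i).comp measurable_snd
    refine (iInf₂_le ρ ⟨?_, fun i => ?_⟩).trans_eq ?_
    · have h1 : ∀ i, ∫⁻ z, edist z (x i) ^ p ∂(ρ i) = ∫⁻ z, h i z.2 * edist z.1 z.2 ^ p ∂π :=
        fun i => by
          have hm : Measurable fun z : E × E => edist z.1 (x i) ^ p :=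
            (measurable_edist_left.comp measurable_fst).pow_const p
          rw [lintegral_map (measurable_edist_left.pow_const p) measurable_fst,
            lintegral_withDensity_eq_lintegral_mul _ (hh2 i) hm]
          refine lintegral_congr fun z => ?_
          by_cases hz : z.2 = x i
          · simp [hz]
          · simp [h, hz]
      have hm : ∀ i, Measurable fun z : E × E => h i z.2 * edist z.1 z.2 ^ p :=
        fun i => (hh2 i).mul hmeas
      simp_rw [h1]
      rw [← lintegral_finsetSum _ fun i _ => hm i]
      refine lintegral_congr_ae ?_
      filter_upwards [hone] with z hz
      rw [← Finset.sum_mul, hz, one_mul]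
    · ext s hs
      rw [Measure.finsetSum_apply, ← hfst, Measure.map_apply measurable_fst hs]
      have : ∀ i, ρ i s = ∫⁻ z in Prod.fst ⁻¹' s, h i z.2 ∂π := fun i => by
        rw [Measure.map_apply measurable_fst hs, withDensity_apply _ (measurable_fst hs)]
      simp_rw [this]
      rw [← lintegral_finsetSum _ fun i _ => hh2 i,
        lintegral_congr_ae (ae_restrict_of_ae hone), setLIntegral_one]
    · have h1 : ρ i Set.univ = ∫⁻ y, h i y ∂(empiricalMeasure x) := by
        rw [Measure.map_apply measurable_fst MeasurableSet.univ, Set.preimage_univ,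
          withDensity_apply _ MeasurableSet.univ, Measure.restrict_univ, ← hsnd,
          lintegral_map (hh i) measurable_snd]
      rw [h1, lintegral_empiricalMeasure x (hh i)]
      have h2 : ∀ j, h i (x j) = ({x j} : Set E).indicator 1 (x i) * (N (x i))⁻¹ := fun j => by
        by_cases hij : x i = x j
        · simp [h, hij]
        · simp [h, hij, Ne.symm hij]
      simp_rw [h2]
      rw [← Finset.sum_mul, ENNReal.mul_inv_cancel (hN0 i) (hNtop _), mul_one]

/-- In the decomposed form the constraint on `ρ` does not involve the sample, and for fixed `ρ` the
cost is continuous in it. An infimum of continuous functions, even an uncountable one, is upper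
semicontinuous. -/
theorem measurable_wassersteinPow_empiricalMeasure {E : Type*} [MetricSpace E] [PolishSpace E]
    [MeasurableSpace E] [BorelSpace E] {p : ℝ} (hp : 0 ≤ p) (μ : Measure E)
    [IsProbabilityMeasure μ] {a : E} {R : ℝ≥0∞} (hR : R ≠ ∞) (hb : ∀ᵐ z ∂μ, edist z a ≤ R)
    {n : ℕ} :
    Measurable fun x : Fin n → E => wassersteinPow p μ (empiricalMeasure x) := by
  simp_rw [wassersteinPow_empiricalMeasure p μ]
  refine UpperSemicontinuous.measurable (upperSemicontinuous_biInf fun ρ hρ => ?_)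
  refine Continuous.upperSemicontinuous (continuous_finsetSum _ fun i _ => ?_)
  have hle : ρ i ≤ μ := by
    rw [← hρ.1]
    exact Finset.single_le_sum (f := ρ) (fun _ _ => Measure.zero_le _) (Finset.mem_univ i)
  have : IsFiniteMeasure (ρ i) := isFiniteMeasure_of_le μ hle
  exact (continuous_lintegral_edist_rpow (ρ i) hp hR (Measure.absolutelyContinuous_of_le hle hb)
    fun x => edist_ne_top a x).comp (continuous_apply i)

/-! ### Greedy couplings along nested partitions. -/

/-- Within each cell `f ⁻¹' {c}` of a finite partition as much mass as possible of `μ` is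
transported to `ν`; `μ'` and `ν'` are what is left. -/
theorem exists_partial_coupling {E ι : Type*} [MeasurableSpace E] [MeasurableSpace ι]
    [MeasurableSingletonClass ι] (C : Finset ι) {f : E → ι} (hf : Measurable f)
    (hC : ∀ x, f x ∈ C) (μ ν : Measure E) [IsFiniteMeasure μ] [IsFiniteMeasure ν] :
    ∃ (π : Measure (E × E)) (μ' ν' : Measure E),
      π.map Prod.fst + μ' = μ ∧ π.map Prod.snd + ν' = ν ∧ (∀ᵐ z ∂π, f z.1 = f z.2) ∧
      μ' Set.univ = ∑ c ∈ C, (μ (f ⁻¹' {c}) - ν (f ⁻¹' {c})) := by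
  have hA : ∀ c, MeasurableSet (f ⁻¹' {c}) := fun c => hf (measurableSet_singleton c)
  have hdecomp : ∀ m : Measure E, ∑ c ∈ C, m.restrict (f ⁻¹' {c}) = m := fun m => by
    ext s hs
    rw [Measure.finsetSum_apply]
    simp_rw [Measure.restrict_apply hs]
    rw [← measure_biUnion_finset]
    · congr 1
      ext x
      simp [hC]
    · intro c _ d _ hcd
      refine Set.disjoint_left.2 fun x hx hx' => hcd ?_
      exact (show f x = c from hx.2).symm.trans hx'.2
    · exact fun c _ => hs.inter (hA c)
  have hinv : ∀ a b : ℝ≥0∞, a ≠ ∞ → b ≤ a → a⁻¹ * b ≤ 1 := fun a b ha hb => by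
    rw [mul_comm, ← div_eq_mul_inv]
    exact ENNReal.div_le_of_le_mul (by rwa [one_mul])
  set M : ι → ℝ≥0∞ := fun c => max (μ (f ⁻¹' {c})) (ν (f ⁻¹' {c})) with hM
  have hMtop : ∀ c, M c ≠ ∞ := fun c => (max_lt (measure_lt_top _ _) (measure_lt_top _ _)).ne
  -- Dividing the product of the restrictions by the larger of the two masses transports exactly the
  -- smaller one. If both vanish, `∞ * 0 = 0` keeps the formulas valid.
  refine ⟨∑ c ∈ C, (M c)⁻¹ • (μ.restrict (f ⁻¹' {c})).prod (ν.restrict (f ⁻¹' {c})),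
    ∑ c ∈ C, (1 - (M c)⁻¹ * ν (f ⁻¹' {c})) • μ.restrict (f ⁻¹' {c}),
    ∑ c ∈ C, (1 - (M c)⁻¹ * μ (f ⁻¹' {c})) • ν.restrict (f ⁻¹' {c}), ?_, ?_, ?_, ?_⟩
  · rw [Measure.map_finset_sum measurable_fst.aemeasurable, ← Finset.sum_add_distrib]
    nth_rewrite 3 [← hdecomp μ]
    refine Finset.sum_congr rfl fun c _ => ?_
    rw [Measure.map_smul, Measure.map_fst_prod, smul_smul, ← add_smul, Measure.restrict_apply_univ,
      add_tsub_cancel_of_le (hinv _ _ (hMtop c) (le_max_right _ _)), one_smul]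
  · rw [Measure.map_finset_sum measurable_snd.aemeasurable, ← Finset.sum_add_distrib]
    nth_rewrite 3 [← hdecomp ν]
    refine Finset.sum_congr rfl fun c _ => ?_
    rw [Measure.map_smul, Measure.map_snd_prod, smul_smul, ← add_smul, Measure.restrict_apply_univ,
      add_tsub_cancel_of_le (hinv _ _ (hMtop c) (le_max_left _ _)), one_smul]
  · rw [ae_iff, Measure.finsetSum_apply]
    refine Finset.sum_eq_zero fun c _ => ?_
    rw [Measure.smul_apply, Measure.prod_restrict, smul_eq_mul]
    refine mul_eq_zero_of_right _ ?_
    rw [← ae_iff]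
    filter_upwards [ae_restrict_mem ((hA c).prod (hA c))] with z hz
    exact (show f z.1 = c from hz.1).trans (show f z.2 = c from hz.2).symm
  · rw [Measure.finsetSum_apply]
    refine Finset.sum_congr rfl fun c _ => ?_
    rw [Measure.smul_apply, Measure.restrict_apply_univ, smul_eq_mul]
    have ha : μ (f ⁻¹' {c}) ≠ ∞ := measure_ne_top _ _
    have hb : ν (f ⁻¹' {c}) ≠ ∞ := measure_ne_top _ _
    simp only [hM]
    generalize μ (f ⁻¹' {c}) = a at *
    generalize ν (f ⁻¹' {c}) = b at *
    rcases le_or_gt a b with hab | hab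
    · rw [max_eq_right hab, tsub_eq_zero_of_le hab]
      rcases eq_or_ne b 0 with rfl | hb0
      · simp [nonpos_iff_eq_zero.1 hab]
      · rw [ENNReal.inv_mul_cancel hb0 hb, tsub_self, zero_mul]
    · rw [max_eq_left hab.le, ENNReal.sub_mul fun _ _ => ha, one_mul, mul_right_comm,
        ENNReal.inv_mul_cancel hab.ne_bot ha, one_mul]

/-- `π` stays within fibres of `f` and `B` is a union of fibres, so both marginals of `π` give `B`
the same mass, which cancels. Thus matching at a fine level leaves the excess on coarser cells
unchanged. -/
theorem tsub_eq_of_partial_coupling {E ι : Type*} [MeasurableSpace E] {f : E → ι}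
    {μ ν μ' ν' : Measure E} [IsFiniteMeasure μ] {π : Measure (E × E)}
    (h1 : π.map Prod.fst + μ' = μ) (h2 : π.map Prod.snd + ν' = ν)
    (hae : ∀ᵐ z ∂π, f z.1 = f z.2) {B : Set E} (hB : MeasurableSet B)
    (hfB : ∀ x y, f x = f y → (x ∈ B ↔ y ∈ B)) :
    μ B - ν B = μ' B - ν' B := by
  have heq : π.map Prod.fst B = π.map Prod.snd B := by
    rw [Measure.map_apply measurable_fst hB, Measure.map_apply measurable_snd hB]
    refine measure_congr ?_
    filter_upwards [hae] with z hz
    exact propext (hfB _ _ hz)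
  have hfin : π.map Prod.snd B ≠ ∞ := by
    rw [← heq]
    refine ((le_add_right le_rfl).trans_lt (?_ : π.map Prod.fst B + μ' B < ∞)).ne
    rw [← Measure.add_apply, h1]
    exact measure_lt_top _ _
  rw [← h1, ← h2, Measure.add_apply, Measure.add_apply, heq, add_comm _ (μ' B),
    add_comm _ (ν' B), ENNReal.add_sub_add_eq_sub_right hfin]

theorem measure_univ_eq_of_partial_coupling {E : Type*} [MeasurableSpace E]
    {μ ν μ' ν' : Measure E} [IsFiniteMeasure μ] {π : Measure (E × E)}
    (h1 : π.map Prod.fst + μ' = μ) (h2 : π.map Prod.snd + ν' = ν)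
    (hmass : μ Set.univ = ν Set.univ) : μ' Set.univ = ν' Set.univ := by
  have e1 : π Set.univ + μ' Set.univ = μ Set.univ := by
    rw [← h1, Measure.add_apply, Measure.map_apply measurable_fst MeasurableSet.univ,
      Set.preimage_univ]
  have e2 : π Set.univ + ν' Set.univ = ν Set.univ := by
    rw [← h2, Measure.add_apply, Measure.map_apply measurable_snd MeasurableSet.univ,
      Set.preimage_univ]
  have hfin : π Set.univ ≠ ∞ :=
    ((le_add_right le_rfl).trans_lt (e1.symm ▸ measure_lt_top μ _)).ne
  exact (ENNReal.add_right_inj hfin).1 (e1.trans (hmass.trans e2.symm))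

/-- Induction on the depth: match within the finest cells, then apply the hypothesis to the two
remainders. Level `0` is a single cell and the masses agree, so nothing is left at the end. -/
theorem exists_coupling_of_nested_partitions {E ι : Type*} [MeasurableSpace E]
    [MeasurableSpace ι] [MeasurableSingletonClass ι] (C : ℕ → Finset ι) (f : ℕ → E → ι)
    (T : Set E) (cost : E × E → ℝ≥0∞) (D : ℕ → ℝ≥0∞) (K : ℕ)
    (hf : ∀ k ≤ K, Measurable (f k)) (hC : ∀ k ≤ K, ∀ x, f k x ∈ C k)
    (hnest : ∀ k l, k ≤ l → l ≤ K → ∀ x y, f l x = f l y → f k x = f k y)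
    (h0 : ∀ x y, f 0 x = f 0 y)
    (hD : ∀ k ≤ K, ∀ x ∈ T, ∀ y ∈ T, f k x = f k y → cost (x, y) ≤ D k)
    (μ ν : Measure E) [IsFiniteMeasure μ] [IsFiniteMeasure ν] (hmass : μ Set.univ = ν Set.univ)
    (hμ : ∀ᵐ x ∂μ, x ∈ T) (hν : ∀ᵐ x ∂ν, x ∈ T) :
    ∃ π : Measure (E × E), π.map Prod.fst = μ ∧ π.map Prod.snd = ν ∧
      ∫⁻ z, cost z ∂π ≤ D K * μ Set.univ + ∑ k ∈ Finset.range K,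
        D k * ∑ c ∈ C (k + 1), (μ (f (k + 1) ⁻¹' {c}) - ν (f (k + 1) ⁻¹' {c})) := by
  induction K generalizing μ ν with
  | zero =>
    obtain ⟨π, μ', ν', h1, h2, hae, hrest⟩ :=
      exists_partial_coupling (C 0) (hf 0 le_rfl) (hC 0 le_rfl) μ ν
    have hμ' : μ' = 0 := by
      rw [← Measure.measure_univ_eq_zero, hrest]
      refine Finset.sum_eq_zero fun c _ => ?_
      rcases Set.eq_empty_or_nonempty (f 0 ⁻¹' {c}) with h | ⟨x, hx⟩
      · simp [h]
      · have : f 0 ⁻¹' {c} = Set.univ :=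
          Set.eq_univ_of_forall fun y => (h0 y x).trans hx
        rw [this, hmass, tsub_self]
    have hν' : ν' = 0 := by
      rw [← Measure.measure_univ_eq_zero, ← measure_univ_eq_of_partial_coupling h1 h2 hmass, hμ',
        Measure.coe_zero, Pi.zero_apply]
    rw [hμ', add_zero] at h1
    rw [hν', add_zero] at h2
    refine ⟨π, h1, h2, ?_⟩
    have hT1 : ∀ᵐ z ∂π, z.1 ∈ T := ae_of_ae_map measurable_fst.aemeasurable (h1 ▸ hμ)
    have hT2 : ∀ᵐ z ∂π, z.2 ∈ T := ae_of_ae_map measurable_snd.aemeasurable (h2 ▸ hν)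
    rw [Finset.range_zero, Finset.sum_empty, add_zero, ← h1,
      Measure.map_apply measurable_fst MeasurableSet.univ, Set.preimage_univ, ← lintegral_const]
    refine lintegral_mono_ae ?_
    filter_upwards [hae, hT1, hT2] with z hz hz1 hz2
    exact hD 0 le_rfl _ hz1 _ hz2 hz
  | succ K ih =>
    obtain ⟨π, μ', ν', h1, h2, hae, hrest⟩ :=
      exists_partial_coupling (C (K + 1)) (hf _ le_rfl) (hC _ le_rfl) μ ν
    have hμ'le : μ' ≤ μ := h1 ▸ Measure.le_add_left le_rfl
    have hν'le : ν' ≤ ν := h2 ▸ Measure.le_add_left le_rfl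
    have hπ1 : π.map Prod.fst ≤ μ := h1 ▸ Measure.le_add_right le_rfl
    have hπ2 : π.map Prod.snd ≤ ν := h2 ▸ Measure.le_add_right le_rfl
    have : IsFiniteMeasure μ' := isFiniteMeasure_of_le μ hμ'le
    have : IsFiniteMeasure ν' := isFiniteMeasure_of_le ν hν'le
    obtain ⟨π', h1', h2', hcost⟩ := ih (fun k hk => hf k (hk.trans K.le_succ))
      (fun k hk => hC k (hk.trans K.le_succ))
      (fun k l hkl hl => hnest k l hkl (hl.trans K.le_succ))
      (fun k hk => hD k (hk.trans K.le_succ)) μ' ν'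
      (measure_univ_eq_of_partial_coupling h1 h2 hmass)
      (Measure.absolutelyContinuous_of_le hμ'le hμ) (Measure.absolutelyContinuous_of_le hν'le hν)
    have hT1 : ∀ᵐ z ∂π, z.1 ∈ T :=
      ae_of_ae_map measurable_fst.aemeasurable (Measure.absolutelyContinuous_of_le hπ1 hμ)
    have hT2 : ∀ᵐ z ∂π, z.2 ∈ T :=
      ae_of_ae_map measurable_snd.aemeasurable (Measure.absolutelyContinuous_of_le hπ2 hν)
    refine ⟨π + π', ?_, ?_, ?_⟩
    · rw [Measure.map_add _ _ measurable_fst, h1', h1]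
    · rw [Measure.map_add _ _ measurable_snd, h2', h2]
    have hcost1 : ∫⁻ z, cost z ∂π ≤ D (K + 1) * μ Set.univ := by
      calc ∫⁻ z, cost z ∂π ≤ ∫⁻ _, D (K + 1) ∂π := by
            refine lintegral_mono_ae ?_
            filter_upwards [hae, hT1, hT2] with z hz hz1 hz2
            exact hD _ le_rfl _ hz1 _ hz2 hz
        _ = D (K + 1) * π.map Prod.fst Set.univ := by
            rw [lintegral_const, Measure.map_apply measurable_fst MeasurableSet.univ,
              Set.preimage_univ]
        _ ≤ D (K + 1) * μ Set.univ := by gcongr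
    have hsum : ∑ k ∈ Finset.range K, D k *
          ∑ c ∈ C (k + 1), (μ' (f (k + 1) ⁻¹' {c}) - ν' (f (k + 1) ⁻¹' {c})) =
        ∑ k ∈ Finset.range K, D k *
          ∑ c ∈ C (k + 1), (μ (f (k + 1) ⁻¹' {c}) - ν (f (k + 1) ⁻¹' {c})) := by
      refine Finset.sum_congr rfl fun k hk => ?_
      have hkK : k + 1 ≤ K + 1 := Nat.succ_le_succ (Finset.mem_range.1 hk).le
      congr 1
      refine Finset.sum_congr rfl fun c _ => ?_
      refine (tsub_eq_of_partial_coupling h1 h2 hae (hf _ hkK (measurableSet_singleton c)) ?_).symm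
      intro x y hxy
      simp only [Set.mem_preimage, Set.mem_singleton_iff]
      rw [hnest _ _ hkK le_rfl x y hxy]
    -- The term `D K * μ' univ` of the induction hypothesis becomes the new summand `k = K`.
    rw [hsum, hrest] at hcost
    rw [lintegral_add_measure, Finset.sum_range_succ, add_comm (Finset.sum _ _)]
    exact add_le_add hcost1 hcost

/-! ### Moments of the excess mass over a finite partition. -/

theorem measureReal_empiricalMeasure {E : Type*} [MeasurableSpace E] {n : ℕ} (x : Fin n → E)
    {s : Set E} (hs : MeasurableSet s) :
    (empiricalMeasure x).real s = (n : ℝ)⁻¹ * ∑ i, s.indicator 1 (x i) := by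
  rw [measureReal_def, empiricalMeasure_apply x hs, ENNReal.toReal_mul, ENNReal.toReal_inv,
    ENNReal.toReal_natCast, ENNReal.toReal_sum]
  · congr 1
    refine Finset.sum_congr rfl fun i _ => ?_
    by_cases h : x i ∈ s <;> simp [h]
  · intro i _
    by_cases h : x i ∈ s <;> simp [h]

theorem aemeasurable_measureReal_empiricalMeasure {E Ω : Type*} [MeasurableSpace E]
    [MeasurableSpace Ω] {P : Measure Ω} {n : ℕ} {X : Fin n → Ω → E}
    (hX : ∀ i, AEMeasurable (X i) P) {s : Set E} (hs : MeasurableSet s) :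
    AEMeasurable (fun ω => (empiricalMeasure fun i => X i ω).real s) P := by
  simp_rw [measureReal_empiricalMeasure _ hs]
  refine (Finset.aemeasurable_fun_sum _ fun i _ => ?_).const_mul _
  exact (measurable_one.indicator hs).comp_aemeasurable (hX i)

/-- Hoeffding: each centred indicator is sub-Gaussian with parameter `1 / 4`, the sum with `n / 4`,
evaluated at `-t / n`. -/
theorem lintegral_exp_measureReal_sub_empiricalMeasure_le {E Ω : Type*} [MeasurableSpace E]
    [MeasurableSpace Ω] {P : Measure Ω} [IsProbabilityMeasure P] {μ : Measure E}
    {n : ℕ} (hn : n ≠ 0) {X : Fin n → Ω → E} (hX : ∀ i, HasLaw (X i) μ P) (hind : iIndepFun X P)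
    {s : Set E} (hs : MeasurableSet s) (t : ℝ) :
    ∫⁻ ω, ENNReal.ofReal
        (Real.exp (t * (μ.real s - (empiricalMeasure fun i => X i ω).real s))) ∂P ≤
      ENNReal.ofReal (Real.exp (t ^ 2 / (8 * n))) := by
  have hn' : (n : ℝ) ≠ 0 := Nat.cast_ne_zero.2 hn
  have hg : Measurable (s.indicator (1 : E → ℝ)) := measurable_one.indicator hs
  let Y : Fin n → Ω → ℝ := fun i ω => s.indicator (1 : E → ℝ) (X i ω)
  have hY : ∀ i, AEMeasurable (Y i) P := fun i => hg.comp_aemeasurable (hX i).aemeasurable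
  have hmean : ∀ i, ∫ ω, Y i ω ∂P = μ.real s := fun i => by
    rw [← (hX i).map_eq, ← integral_indicator_one hs, integral_map (hX i).aemeasurable
      hg.aestronglyMeasurable]
  have hsub : ∀ i, HasSubgaussianMGF (fun ω => Y i ω - μ.real s) ((‖(1 : ℝ) - 0‖₊ / 2) ^ 2) P :=
    fun i => by
      rw [← hmean i]
      refine hasSubgaussianMGF_of_mem_Icc (hY i) (Filter.Eventually.of_forall fun ω => ?_)
      by_cases h : X i ω ∈ s <;> simp [Y, h]
  have hindY : iIndepFun (fun i ω => Y i ω - μ.real s) P :=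
    hind.comp (fun _ x => s.indicator (1 : E → ℝ) x - μ.real s) fun _ => hg.sub_const _
  have hsum := HasSubgaussianMGF.sum_of_iIndepFun hindY (s := Finset.univ) fun i _ => hsub i
  have hmgf := hsum.mgf_le (-t / n)
  have hint := hsum.integrable_exp_mul (-t / n)
  have heq : ∀ ω, t * (μ.real s - (empiricalMeasure fun i => X i ω).real s) =
      -t / n * ∑ i, (Y i ω - μ.real s) := fun ω => by
    rw [measureReal_empiricalMeasure _ hs, Finset.sum_sub_distrib]
    simp only [Finset.sum_const, Finset.card_univ, Fintype.card_fin, nsmul_eq_mul, Y]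
    field_simp
    ring
  simp_rw [heq]
  rw [← ofReal_integral_eq_lintegral_ofReal hint
    (Filter.Eventually.of_forall fun ω => (Real.exp_pos _).le)]
  refine ENNReal.ofReal_le_ofReal (hmgf.trans_eq ?_)
  congr 1
  simp only [sub_zero, nnnorm_one, Finset.sum_const, Finset.card_univ, Fintype.card_fin,
    nsmul_eq_mul, NNReal.coe_mul, NNReal.coe_natCast, NNReal.coe_pow, NNReal.coe_div,
    NNReal.coe_one, NNReal.coe_ofNat]
  field_simp
  norm_num
  ring

/-- Raise `u ≤ exp u`, at `u = t x / M`, to the power `M`. -/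
theorem ofReal_rpow_le_mul_exp {M t : ℝ} (hM : 0 < M) (ht : 0 < t) (x : ℝ) :
    ENNReal.ofReal x ^ M ≤ ENNReal.ofReal ((M / t) ^ M) * ENNReal.ofReal (Real.exp (t * x)) := by
  rcases le_or_gt x 0 with hx | hx
  · rw [ENNReal.ofReal_of_nonpos hx, ENNReal.zero_rpow_of_pos hM]
    exact zero_le
  · rw [ENNReal.ofReal_rpow_of_pos hx, ← ENNReal.ofReal_mul (by positivity)]
    refine ENNReal.ofReal_le_ofReal ?_
    have h1 : x = M / t * (t * x / M) := by field_simp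
    have h2 : t * x / M ≤ Real.exp (t * x / M) :=
      (by linarith : t * x / M ≤ t * x / M + 1).trans (Real.add_one_le_exp _)
    calc x ^ M = (M / t) ^ M * (t * x / M) ^ M := by
          rw [← Real.mul_rpow (by positivity) (by positivity), ← h1]
      _ ≤ (M / t) ^ M * Real.exp (t * x / M) ^ M := by gcongr
      _ = (M / t) ^ M * Real.exp (t * x) := by
          rw [← Real.exp_mul]
          congr 2
          field_simp

/-- Take `U` to be the cells where `ν ≤ μ`; on the others truncated subtraction gives zero. -/
theorem exists_sum_tsub_eq {E ι : Type*} [MeasurableSpace E] [MeasurableSpace ι]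
    [MeasurableSingletonClass ι] (C : Finset ι) {f : E → ι} (hf : Measurable f)
    (μ ν : Measure E) [IsFiniteMeasure μ] [IsFiniteMeasure ν] :
    ∃ U ∈ C.powerset, ∑ c ∈ C, (μ (f ⁻¹' {c}) - ν (f ⁻¹' {c})) =
      ENNReal.ofReal (μ.real (f ⁻¹' U) - ν.real (f ⁻¹' U)) := by
  classical
  have hA : ∀ c, MeasurableSet (f ⁻¹' {c}) := fun c => hf (measurableSet_singleton c)
  refine ⟨C.filter fun c => ν (f ⁻¹' {c}) ≤ μ (f ⁻¹' {c}),
    Finset.mem_powerset.2 (Finset.filter_subset _ _), ?_⟩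
  have hreal : ∀ (m : Measure E) [IsFiniteMeasure m] (U : Finset ι),
      m.real (f ⁻¹' U) = ∑ c ∈ U, m.real (f ⁻¹' {c}) := fun m _ U => by
    rw [← measureReal_biUnion_finset]
    · congr 1
      ext x
      simp
    · intro c _ d _ hcd
      exact Set.disjoint_left.2 fun x hx hx' => hcd (hx.symm.trans hx')
    · exact fun c _ => hA c
  rw [hreal μ, hreal ν, ← Finset.sum_sub_distrib, ENNReal.ofReal_sum_of_nonneg, Finset.sum_filter]
  · refine Finset.sum_congr rfl fun c _ => ?_
    split_ifs with h
    · rw [ENNReal.ofReal_sub _ measureReal_nonneg, ofReal_measureReal, ofReal_measureReal]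
    · exact tsub_eq_zero_of_le (not_le.1 h).le
  · intro c hc
    exact sub_nonneg.2 (ENNReal.toReal_mono (measure_ne_top _ _) (Finset.mem_filter.1 hc).2)

theorem aemeasurable_sum_tsub_empiricalMeasure {E ι Ω : Type*} [MeasurableSpace E]
    [MeasurableSpace ι] [MeasurableSingletonClass ι] [MeasurableSpace Ω] {P : Measure Ω}
    {n : ℕ} (hn : n ≠ 0) (μ : Measure E) {X : Fin n → Ω → E} (hX : ∀ i, AEMeasurable (X i) P)
    (C : Finset ι) {f : E → ι} (hf : Measurable f) :
    AEMeasurable (fun ω => ∑ c ∈ C,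
      (μ (f ⁻¹' {c}) - empiricalMeasure (fun i => X i ω) (f ⁻¹' {c}))) P := by
  have hemp : ∀ x : Fin n → E, IsProbabilityMeasure (empiricalMeasure x) :=
    isProbabilityMeasure_empiricalMeasure hn
  refine Finset.aemeasurable_fun_sum _ fun c _ => AEMeasurable.const_sub ?_ _
  refine ((aemeasurable_measureReal_empiricalMeasure hX
    (hf (measurableSet_singleton c))).ennreal_ofReal).congr
    (Filter.Eventually.of_forall fun ω => ?_)
  exact ofReal_measureReal

/-- Passing to the larger exponent `M` makes the union bound cheap: the `M`-th root of the number `2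
^ card` of unions is at most `2`. -/
theorem eLpNorm_sum_tsub_empiricalMeasure_le {E ι Ω : Type*} [MeasurableSpace E]
    [MeasurableSpace ι] [MeasurableSingletonClass ι]
    [MeasurableSpace Ω] {P : Measure Ω} [IsProbabilityMeasure P] {μ : Measure E}
    [IsProbabilityMeasure μ] {n : ℕ} (hn : n ≠ 0) {X : Fin n → Ω → E}
    (hX : ∀ i, HasLaw (X i) μ P) (hind : iIndepFun X P) (C : Finset ι) {f : E → ι}
    (hf : Measurable f) {r M : ℝ} (hr : 0 < r) (hrM : r ≤ M) (hCM : C.card ≤ M) :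
    eLpNorm (fun ω => ∑ c ∈ C,
        (μ (f ⁻¹' {c}) - empiricalMeasure (fun i => X i ω) (f ⁻¹' {c}))) (ENNReal.ofReal r) P ≤
      ENNReal.ofReal (4 * √(M / n)) := by
  have hM : 0 < M := hr.trans_le hrM
  have hn' : (0 : ℝ) < n := Nat.cast_pos.2 (Nat.pos_of_ne_zero hn)
  have hemp : ∀ x : Fin n → E, IsProbabilityMeasure (empiricalMeasure x) :=
    isProbabilityMeasure_empiricalMeasure hn
  have hXm : ∀ i, AEMeasurable (X i) P := fun i => (hX i).aemeasurable
  have hmeas := aemeasurable_sum_tsub_empiricalMeasure hn μ hXm C hf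
  refine (eLpNorm_le_eLpNorm_of_exponent_le (ENNReal.ofReal_le_ofReal hrM)
    hmeas.aestronglyMeasurable).trans ?_
  rw [eLpNorm_eq_lintegral_rpow_enorm_toReal (by simpa using hM) ENNReal.ofReal_ne_top,
    ENNReal.toReal_ofReal hM.le, one_div, ENNReal.rpow_inv_le_iff hM]
  -- This `t` gives `M / t = √(M / n)` and `exp (t² / (8n)) = exp (1 / 8) ^ M`. The constant `4` is
  -- `2` from the union bound times `2 ≥ exp (1 / 8)`.
  set t : ℝ := √(n * M) with ht
  have htpos : 0 < t := Real.sqrt_pos.2 (by positivity)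
  have ht2 : t ^ 2 = n * M := Real.sq_sqrt (by positivity)
  have hpt : ∀ ω, ‖∑ c ∈ C,
      (μ (f ⁻¹' {c}) - empiricalMeasure (fun i => X i ω) (f ⁻¹' {c}))‖ₑ ^ M ≤
      ∑ U ∈ C.powerset, ENNReal.ofReal ((M / t) ^ M) * ENNReal.ofReal (Real.exp
        (t * (μ.real (f ⁻¹' U) - (empiricalMeasure fun i => X i ω).real (f ⁻¹' U)))) := fun ω => by
    obtain ⟨U, hU, hUeq⟩ := exists_sum_tsub_eq C hf μ (empiricalMeasure fun i => X i ω)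
    rw [hUeq, enorm_eq_self]
    refine (ofReal_rpow_le_mul_exp hM htpos _).trans ?_
    exact Finset.single_le_sum (f := fun U : Finset ι => ENNReal.ofReal ((M / t) ^ M) *
      ENNReal.ofReal (Real.exp (t * (μ.real (f ⁻¹' U) -
        (empiricalMeasure fun i => X i ω).real (f ⁻¹' U))))) (fun _ _ => zero_le) hU
  have hU : ∀ U : Finset ι, MeasurableSet (f ⁻¹' U) := fun U => hf U.measurableSet
  have hm : ∀ U : Finset ι, AEMeasurable (fun ω => ENNReal.ofReal (Real.exp
        (t * (μ.real (f ⁻¹' U) - (empiricalMeasure fun i => X i ω).real (f ⁻¹' U))))) P :=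
    fun U => (Real.measurable_exp.comp_aemeasurable
      (((aemeasurable_measureReal_empiricalMeasure hXm (hU U)).const_sub _).const_mul
        t)).ennreal_ofReal
  have hreal : (M / t) ^ M * (2 ^ (C.card : ℝ) * Real.exp (t ^ 2 / (8 * n))) ≤
      (4 * √(M / n)) ^ M := by
    have e1 : M / t = √(M / n) := by
      rw [ht, div_eq_iff htpos.ne', ← Real.sqrt_mul (by positivity)]
      rw [show M / n * (n * M) = M ^ 2 by field_simp, Real.sqrt_sq hM.le]
    have e2 : Real.exp (t ^ 2 / (8 * n)) = Real.exp (1 / 8) ^ M := by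
      rw [← Real.exp_mul, ht2]
      congr 1
      field_simp
    have e3 : Real.exp (1 / 8) ≤ 2 := by
      have h := Real.exp_one_lt_d9
      calc Real.exp (1 / 8) ≤ Real.exp (Real.log 2) := by
            refine Real.exp_le_exp.2 ?_
            have := Real.log_two_gt_d9
            linarith
        _ = 2 := Real.exp_log two_pos
    calc (M / t) ^ M * (2 ^ (C.card : ℝ) * Real.exp (t ^ 2 / (8 * n)))
        ≤ √(M / n) ^ M * (2 ^ M * 2 ^ M) := by
          rw [e1, e2]
          gcongr
          norm_num
      _ = (4 * √(M / n)) ^ M := by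
          rw [Real.mul_rpow (by norm_num) (Real.sqrt_nonneg _), ← Real.mul_rpow two_pos.le two_pos.le]
          norm_num
          ring
  calc ∫⁻ ω, ‖∑ c ∈ C,
        (μ (f ⁻¹' {c}) - empiricalMeasure (fun i => X i ω) (f ⁻¹' {c}))‖ₑ ^ M ∂P
      ≤ ∫⁻ ω, ∑ U ∈ C.powerset, ENNReal.ofReal ((M / t) ^ M) * ENNReal.ofReal (Real.exp
        (t * (μ.real (f ⁻¹' U) - (empiricalMeasure fun i => X i ω).real (f ⁻¹' U)))) ∂P :=
        lintegral_mono hpt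
    _ = ∑ U ∈ C.powerset, ENNReal.ofReal ((M / t) ^ M) * ∫⁻ ω, ENNReal.ofReal (Real.exp
        (t * (μ.real (f ⁻¹' U) - (empiricalMeasure fun i => X i ω).real (f ⁻¹' U)))) ∂P := by
        rw [lintegral_finsetSum' _ fun U _ => (hm U).const_mul _]
        exact Finset.sum_congr rfl fun U _ => lintegral_const_mul'' _ (hm U)
    _ ≤ ∑ U ∈ C.powerset, ENNReal.ofReal ((M / t) ^ M) *
          ENNReal.ofReal (Real.exp (t ^ 2 / (8 * n))) := by
        gcongr with U _
        exact lintegral_exp_measureReal_sub_empiricalMeasure_le hn hX hind (hU U) t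
    _ = ENNReal.ofReal ((M / t) ^ M * (2 ^ (C.card : ℝ) * Real.exp (t ^ 2 / (8 * n)))) := by
        rw [Finset.sum_const, Finset.card_powerset, nsmul_eq_mul, Real.rpow_natCast,
          ENNReal.ofReal_mul (by positivity), ENNReal.ofReal_mul (by positivity),
          ENNReal.ofReal_pow (by norm_num)]
        push_cast
        rw [ENNReal.ofReal_ofNat]
        ring
    _ ≤ ENNReal.ofReal (4 * √(M / n)) ^ M := by
        rw [ENNReal.ofReal_rpow_of_nonneg (by positivity) hM.le]
        exact ENNReal.ofReal_le_ofReal hreal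

/-! ### Nested partitions from nets. -/

theorem exists_measurable_nearest {E : Type*} [PseudoMetricSpace E] [SecondCountableTopology E]
    [MeasurableSpace E] [OpensMeasurableSpace E] (C : Finset E) (hC : C.Nonempty) :
    ∃ g : E → E, Measurable g ∧ (∀ x, g x ∈ C) ∧ ∀ x, ∀ c ∈ C, dist (g x) x ≤ dist c x := by
  classical
  induction hC using Finset.Nonempty.cons_induction with
  | singleton a => exact ⟨fun _ => a, measurable_const, by simp, by simp⟩
  | cons a s ha hs ih =>
    obtain ⟨g, hg, hgs, hmin⟩ := ih
    refine ⟨fun x => if dist a x < dist (g x) x then a else g x, ?_, fun x => ?_, fun x => ?_⟩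
    · exact Measurable.ite (measurableSet_lt (measurable_const.dist measurable_id)
        (hg.dist measurable_id)) measurable_const hg
    · dsimp only
      split_ifs
      · exact Finset.mem_cons_self a s
      · exact Finset.mem_cons_of_mem (hgs x)
    · intro c hc
      rcases Finset.mem_cons.1 hc with rfl | hc
      · dsimp only
        split_ifs with h
        · exact le_rfl
        · exact not_lt.1 h
      · dsimp only
        split_ifs with h
        · exact h.le.trans (hmin x c hc)
        · exact hmin x c hc

/-- Composing nearest-point maps onto finer and finer nets gives maps whose fibres are nested. -/
theorem exists_nested_nearest_maps {E : Type*} [PseudoMetricSpace E] [SecondCountableTopology E]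
    [MeasurableSpace E] [OpensMeasurableSpace E] {T : Set E} (C : ℕ → Finset E) {Δ : ℝ}
    (hne : ∀ k, (C k).Nonempty) (hCT : ∀ k, ∀ c ∈ C k, c ∈ T)
    (hcov : ∀ k, ∀ x ∈ T, ∃ c ∈ C k, dist c x ≤ Δ / 2 ^ k) (K : ℕ) :
    ∃ f : ℕ → E → E, (∀ k ≤ K, Measurable (f k)) ∧ (∀ k ≤ K, ∀ x, f k x ∈ C k) ∧
      (∀ k l, k ≤ l → l ≤ K → ∀ x y, f l x = f l y → f k x = f k y) ∧
      ∀ k ≤ K, ∀ x ∈ T, dist (f k x) x ≤ 2 * (Δ / 2 ^ k) - Δ / 2 ^ K := by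
  induction K with
  | zero =>
    obtain ⟨g, hg, hgC, hmin⟩ := exists_measurable_nearest (C 0) (hne 0)
    refine ⟨fun _ => g, fun _ _ => hg, fun k hk => ?_, fun _ _ _ _ _ _ h => h, fun k hk x hx => ?_⟩
    · rwa [Nat.le_zero.1 hk]
    · obtain ⟨c, hc, hcx⟩ := hcov 0 x hx
      rw [Nat.le_zero.1 hk]
      linarith [hmin x c hc]
  | succ K ih =>
    obtain ⟨f, hf, hfC, hnest, hdist⟩ := ih
    obtain ⟨g, hg, hgC, hmin⟩ := exists_measurable_nearest (C (K + 1)) (hne (K + 1))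
    have hgd : ∀ x ∈ T, dist (g x) x ≤ Δ / 2 ^ (K + 1) := fun x hx => by
      obtain ⟨c, hc, hcx⟩ := hcov (K + 1) x hx
      exact (hmin x c hc).trans hcx
    -- Precomposing every coarser map with `g` makes it factor through `g`, hence the nesting.
    refine ⟨fun k => if k ≤ K then f k ∘ g else g, fun k hk => ?_, fun k hk x => ?_, ?_,
      fun k hk x hx => ?_⟩
    · dsimp only
      split_ifs with h
      · exact (hf k h).comp hg
      · exact hg
    · dsimp only
      split_ifs with h
      · exact hfC k h (g x)
      · rw [show k = K + 1 by omega]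
        exact hgC x
    · intro k l hkl hl x y hxy
      dsimp only at hxy ⊢
      split_ifs at hxy with h
      · rw [if_pos (hkl.trans h)]
        exact hnest k l hkl h _ _ hxy
      · split_ifs
        · exact congrArg (f k) hxy
        · exact hxy
    · dsimp only
      split_ifs with h
      -- The correction `-Δ / 2 ^ K` in the bound closes the induction: passing to `K + 1` frees
      -- exactly the `Δ / 2 ^ (K + 1)` that `g` adds.
      · have h1 := hdist k h (g x) (hCT _ _ (hgC x))
        have h2 := hgd x hx
        have h3 := dist_triangle (f k (g x)) (g x) x
        have h4 : Δ / 2 ^ (K + 1) = Δ / 2 ^ K / 2 := by rw [pow_succ, div_div]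
        simp only [Function.comp_apply]
        linarith
      · rw [show k = K + 1 by omega]
        linarith [hgd x hx]

/-- A finite union of closed balls is closed, so a net of `S` covers `closure S`, which is
measurable even if `S` is not. At level `0` any one point of `S` serves, which yields the single
coarsest cell. -/
theorem FiniteDimensionalType.exists_nets {E : Type*} [MetricSpace E] {S : Set E} {α β : ℝ}
    (h : FiniteDimensionalType S α β) (hS : S.Nonempty) (hΔ : 0 < Metric.diam S) :
    ∃ C : ℕ → Finset E, (C 0).card = 1 ∧ (∀ k, (C k).Nonempty) ∧
      (∀ k, ∀ c ∈ C k, c ∈ closure S) ∧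
      (∀ k, ∀ x ∈ closure S, ∃ c ∈ C k, dist c x ≤ Metric.diam S / 2 ^ k) ∧
      ∀ k, 0 < k → ((C k).card : ℝ) ≤ max (β * (2 ^ k) ^ α) 0 := by
  set Δ := Metric.diam S with hΔdef
  have key : ∀ k : ℕ, ∃ C : Finset E, (k = 0 → C.card = 1) ∧ C.Nonempty ∧
      (∀ c ∈ C, c ∈ closure S) ∧ (∀ x ∈ closure S, ∃ c ∈ C, dist c x ≤ Δ / 2 ^ k) ∧
      (0 < k → (C.card : ℝ) ≤ max (β * (2 ^ k) ^ α) 0) := by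
    intro k
    rcases Nat.eq_zero_or_pos k with rfl | hk
    · obtain ⟨a, ha⟩ := hS
      refine ⟨{a}, by simp, by simp, by simpa using subset_closure ha, fun x hx => ?_, by simp⟩
      refine ⟨a, by simp, ?_⟩
      rw [pow_zero, div_one, hΔdef, ← Metric.diam_closure]
      exact Metric.dist_le_diam_of_mem h.1.closure (subset_closure ha) hx
    · have hδ : 0 < Δ / 2 ^ k := by positivity
      have hle : Δ / 2 ^ k ≤ Δ := div_le_self hΔ.le (one_le_pow₀ one_le_two)
      obtain ⟨δ, hδeq⟩ : ∃ δ : ℝ≥0, (δ : ℝ) = Δ / 2 ^ k := ⟨_, Real.coe_toNNReal _ hδ.le⟩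
      have hcov := h.2 δ (NNReal.coe_pos.1 (hδeq ▸ hδ)) (hδeq ▸ hle)
      obtain ⟨C, hCS, hfin, hcover, hcard⟩ := Metric.exists_set_encard_eq_coveringNumber
        (A := S) (ε := δ) (by
          rintro htop
          rw [htop] at hcov
          exact absurd hcov (by simp))
      have hCne : C.Nonempty := hcover.nonempty hS
      rw [← hcard, hfin.encard_eq_coe_toFinset_card] at hcov
      refine ⟨hfin.toFinset, fun h0 => absurd h0 hk.ne', by simpa using hCne,
        fun c hc => subset_closure (hCS (by simpa using hc)), fun x hx => ?_, fun _ => ?_⟩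
      · have hsub := Metric.isCover_iff_subset_iUnion_closedBall.1 hcover
        have hcl : IsClosed (⋃ y ∈ C, Metric.closedBall y (δ : ℝ)) :=
          hfin.isClosed_biUnion fun _ _ => Metric.isClosed_closedBall
        have := closure_minimal hsub hcl hx
        simp only [Set.mem_iUnion, Metric.mem_closedBall, exists_prop] at this
        obtain ⟨c, hc, hcx⟩ := this
        exact ⟨c, by simpa using hc, by rwa [dist_comm, ← hδeq]⟩
      · have e : Δ / (δ : ℝ) = 2 ^ k := by
          rw [hδeq]
          field_simp
        rw [← hΔdef, e] at hcov
        have h2 := ENNReal.toReal_mono ENNReal.ofReal_ne_top hcov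
        rw [ENNReal.toReal_ofReal'] at h2
        simpa using h2
  choose C h1 h2 h3 h4 h5 using key
  exact ⟨C, h1 0 rfl, h2, h3, h4, h5⟩

theorem wassersteinPow_le_of_nested_partitions {E ι : Type*} [MetricSpace E] [MeasurableSpace E]
    [MeasurableSpace ι] [MeasurableSingletonClass ι] {p : ℝ} (hp : 0 ≤ p)
    (C : ℕ → Finset ι) (f : ℕ → E → ι) (T : Set E) (D : ℕ → ℝ≥0∞) (K : ℕ)
    (hf : ∀ k ≤ K, Measurable (f k)) (hC : ∀ k ≤ K, ∀ x, f k x ∈ C k)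
    (hnest : ∀ k l, k ≤ l → l ≤ K → ∀ x y, f l x = f l y → f k x = f k y)
    (h0 : ∀ x y, f 0 x = f 0 y)
    (hD : ∀ k ≤ K, ∀ x ∈ T, ∀ y ∈ T, f k x = f k y → edist x y ≤ D k)
    (μ ν : Measure E) [IsProbabilityMeasure μ] [IsProbabilityMeasure ν]
    (hμ : ∀ᵐ x ∂μ, x ∈ T) (hν : ∀ᵐ x ∂ν, x ∈ T) :
    wassersteinPow p μ ν ≤ D K ^ p + ∑ k ∈ Finset.range K,
        D k ^ p * ∑ c ∈ C (k + 1), (μ (f (k + 1) ⁻¹' {c}) - ν (f (k + 1) ⁻¹' {c})) := by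
  obtain ⟨π, h1, h2, h3⟩ := exists_coupling_of_nested_partitions C f T
    (fun z => edist z.1 z.2 ^ p) (fun k => D k ^ p) K hf hC hnest h0
    (fun k hk x hx y hy hxy => ENNReal.rpow_le_rpow (hD k hk x hx y hy hxy) hp) μ ν
    (by rw [measure_univ, measure_univ]) hμ hν
  rw [measure_univ, mul_one] at h3
  refine (iInf₂_le π ⟨⟨?_⟩, h1, h2⟩).trans h3
  rw [← Set.preimage_univ (f := Prod.fst), ← Measure.map_apply measurable_fst MeasurableSet.univ, h1,
    measure_univ]

theorem ae_empiricalMeasure_mem {E Ω : Type*} [MeasurableSpace E] [MeasurableSpace Ω]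
    {P : Measure Ω} {μ : Measure E} {n : ℕ} {X : Fin n → Ω → E} (hX : ∀ i, HasLaw (X i) μ P)
    {T : Set E} (hT : MeasurableSet T) (hμ : ∀ᵐ x ∂μ, x ∈ T) :
    ∀ᵐ ω ∂P, ∀ᵐ x ∂(empiricalMeasure fun i => X i ω), x ∈ T := by
  have h : ∀ᵐ ω ∂P, ∀ i, X i ω ∈ T := ae_all_iff.2 fun i =>
    ae_of_ae_map (hX i).aemeasurable ((hX i).map_eq.symm ▸ hμ)
  filter_upwards [h] with ω hω
  change empiricalMeasure _ Tᶜ = 0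
  rw [empiricalMeasure_apply _ hT.compl]
  exact mul_eq_zero_of_right _ (Finset.sum_eq_zero fun i _ => by simp [hω i])

/-! ### Choice of the depth in the three regimes. -/

/-- The multiscale bound with `K` levels, for `s = r / n`. -/
noncomputable def multiscaleBound (α p A s : ℝ) (K : ℕ) : ℝ :=
  ((2 : ℝ) ^ (-p)) ^ K + A * √s * ∑ k ∈ Finset.range K, ((2 : ℝ) ^ (α / 2 - p)) ^ k

/-- The geometric sum is bounded in `K`, so any `K` with `2 ^ (-p K) < √s` works. -/
theorem exists_multiscaleBound_le_of_lt {α p : ℝ} (hp : 1 ≤ p) (h : α < 2 * p) {A : ℝ}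
    (hA : 0 ≤ A) : ∃ c : ℝ, 0 < c ∧ ∀ s : ℝ, 0 < s →
      ∃ K, multiscaleBound α p A s K ≤ c * √s := by
  have hρ : (2 : ℝ) ^ (α / 2 - p) < 1 := Real.rpow_lt_one_of_one_lt_of_neg one_lt_two (by linarith)
  have hρ0 : 0 < (2 : ℝ) ^ (α / 2 - p) := by positivity
  have hq : (2 : ℝ) ^ (-p) < 1 := Real.rpow_lt_one_of_one_lt_of_neg one_lt_two (by linarith)
  refine ⟨1 + A * (1 - (2 : ℝ) ^ (α / 2 - p))⁻¹, ?_, fun s hs => ?_⟩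
  · have : 0 < 1 - (2 : ℝ) ^ (α / 2 - p) := by linarith
    positivity
  · obtain ⟨K, hK⟩ := exists_pow_lt_of_lt_one (Real.sqrt_pos.2 hs) hq
    refine ⟨K, ?_⟩
    have hsum : ∑ k ∈ Finset.range K, ((2 : ℝ) ^ (α / 2 - p)) ^ k ≤
        (1 - (2 : ℝ) ^ (α / 2 - p))⁻¹ := by
      rw [← tsum_geometric_of_lt_one hρ0.le hρ]
      exact (summable_geometric_of_lt_one hρ0.le hρ).sum_le_tsum _ fun _ _ => by positivity
    have := mul_le_mul_of_nonneg_left hsum (mul_nonneg hA (Real.sqrt_nonneg s))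
    unfold multiscaleBound
    linarith

/-- The ratio is `1`, so the sum equals `K`, and a logarithmic depth suffices because `p log 2 ≥ 1 /
2`. -/
theorem exists_multiscaleBound_le_of_eq {α p : ℝ} (hp : 1 ≤ p) (h : α = 2 * p) {A : ℝ}
    (hA : 0 ≤ A) : ∃ c : ℝ, 0 < c ∧ ∀ s : ℝ, 0 < s → s ≤ 1 →
      ∃ K, multiscaleBound α p A s K ≤ c * (√s * Real.log (Real.exp 1 + s⁻¹)) := by
  refine ⟨1 + 2 * A, by positivity, fun s hs hs1 => ⟨⌈Real.log s⁻¹⌉₊, ?_⟩⟩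
  set K := ⌈Real.log s⁻¹⌉₊
  have hlog0 : 0 ≤ Real.log s⁻¹ := Real.log_nonneg ((one_le_inv₀ hs).2 hs1)
  have hKl : Real.log s⁻¹ ≤ K := Nat.le_ceil _
  have hKu : (K : ℝ) ≤ Real.log s⁻¹ + 1 := (Nat.ceil_lt_add_one hlog0).le
  have hinv : 0 < s⁻¹ := inv_pos.2 hs
  have hL1 : 1 ≤ Real.log (Real.exp 1 + s⁻¹) := by
    rw [Real.le_log_iff_exp_le (by positivity)]
    linarith
  have hL2 : Real.log s⁻¹ ≤ Real.log (Real.exp 1 + s⁻¹) :=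
    Real.log_le_log hinv (by linarith [Real.exp_pos 1])
  have hq : ((2 : ℝ) ^ (-p)) ^ K ≤ √s := by
    rw [Real.sqrt_eq_rpow, ← Real.rpow_natCast, ← Real.rpow_mul two_pos.le,
      Real.rpow_def_of_pos two_pos, Real.rpow_def_of_pos hs]
    refine Real.exp_le_exp.2 ?_
    rw [Real.log_inv] at hKl
    have h2 := Real.log_two_gt_d9
    have h3 : 1 / 2 ≤ Real.log 2 * p := by nlinarith
    have h4 : (K : ℝ) * (1 / 2) ≤ K * (Real.log 2 * p) := by gcongr
    nlinarith
  have hρ : (2 : ℝ) ^ (α / 2 - p) = 1 := by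
    rw [show α / 2 - p = 0 by linarith, Real.rpow_zero]
  unfold multiscaleBound
  simp only [hρ, one_pow, Finset.sum_const, Finset.card_range, nsmul_eq_mul, mul_one]
  have hs0 := Real.sqrt_nonneg s
  have e1 : √s ≤ √s * Real.log (Real.exp 1 + s⁻¹) := le_mul_of_one_le_right hs0 hL1
  have e2 : A * √s * K ≤ A * √s * (2 * Real.log (Real.exp 1 + s⁻¹)) := by
    gcongr
    linarith
  linarith

/-- The sum is comparable to its last term. Taking `2 ^ K` of order `s ^ (-1 / α)` balances it
against `2 ^ (-p K)`. -/
theorem exists_multiscaleBound_le_of_gt {α p : ℝ} (hα : 0 < α) (hp : 1 ≤ p) (h : 2 * p < α)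
    {A : ℝ} (hA : 0 ≤ A) : ∃ c : ℝ, 0 < c ∧ ∀ s : ℝ, 0 < s → s ≤ 1 →
      ∃ K, multiscaleBound α p A s K ≤ c * s ^ (p / α) := by
  have hγ : 0 < α / 2 - p := by linarith
  have hρ : 1 < (2 : ℝ) ^ (α / 2 - p) := Real.one_lt_rpow one_lt_two hγ
  set ρ := (2 : ℝ) ^ (α / 2 - p) with hρdef
  have hρ1 : 0 < ρ - 1 := by linarith
  refine ⟨1 + A * (ρ / (ρ - 1)), by positivity, fun s hs hs1 => ?_⟩
  set y := s ^ (-(1 / α)) with hy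
  have hypos : 0 < y := by positivity
  have hy1 : 1 ≤ y := Real.one_le_rpow_of_pos_of_le_one_of_nonpos hs hs1 (by
    have : 0 < 1 / α := by positivity
    linarith)
  obtain ⟨m, hm1, hm2⟩ := exists_nat_pow_near hy1 (one_lt_two (α := ℝ))
  refine ⟨m + 1, ?_⟩
  have hswap : ∀ e : ℝ, ((2 : ℝ) ^ e) ^ (m + 1) = ((2 : ℝ) ^ (m + 1)) ^ e := fun e =>
    Real.rpow_pow_comm two_pos.le e (m + 1)
  have h1 : ((2 : ℝ) ^ (-p)) ^ (m + 1) ≤ s ^ (p / α) := by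
    calc ((2 : ℝ) ^ (-p)) ^ (m + 1) = ((2 : ℝ) ^ (m + 1)) ^ (-p) := hswap _
      _ ≤ y ^ (-p) := Real.rpow_le_rpow_of_nonpos hypos hm2.le (by linarith)
      _ = s ^ (p / α) := by
        rw [hy, ← Real.rpow_mul hs.le]
        congr 1
        ring
  have h2 : ρ ^ (m + 1) ≤ ρ * s ^ (p / α - 1 / 2) := by
    calc ρ ^ (m + 1) = ((2 : ℝ) ^ (m + 1)) ^ (α / 2 - p) := hswap _
      _ ≤ (2 * y) ^ (α / 2 - p) := by
        refine Real.rpow_le_rpow (by positivity) ?_ hγ.le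
        rw [pow_succ']
        linarith
      _ = ρ * s ^ (p / α - 1 / 2) := by
        rw [Real.mul_rpow two_pos.le hypos.le, hy, ← Real.rpow_mul hs.le]
        congr 2
        field_simp
        ring
  have h3 : ∑ k ∈ Finset.range (m + 1), ρ ^ k ≤ ρ ^ (m + 1) / (ρ - 1) := by
    rw [geom_sum_eq hρ.ne']
    gcongr
    linarith
  have h4 : √s * s ^ (p / α - 1 / 2) = s ^ (p / α) := by
    rw [Real.sqrt_eq_rpow, ← Real.rpow_add hs]
    congr 1
    ring
  unfold multiscaleBound
  rw [← hρdef]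
  calc ((2 : ℝ) ^ (-p)) ^ (m + 1) + A * √s * ∑ k ∈ Finset.range (m + 1), ρ ^ k
      ≤ s ^ (p / α) + A * √s * (ρ * s ^ (p / α - 1 / 2) / (ρ - 1)) := by
        gcongr
        exact h3.trans (by gcongr)
    _ = (1 + A * (ρ / (ρ - 1))) * s ^ (p / α) := by
        rw [← h4]
        ring

/-! ### Moment bounds for the transport cost and the final rates. -/

theorem eLpNorm_wassersteinPow_le_multiscaleBound {E : Type*} [MetricSpace E] [PolishSpace E]
    [MeasurableSpace E] [BorelSpace E] {Ω : Type*} [MeasurableSpace Ω] {P : Measure Ω}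
    [IsProbabilityMeasure P] {μ : Measure E} [IsProbabilityMeasure μ] {S : Set E} {α β p : ℝ}
    (hα : 0 < α) (hp : 1 ≤ p) (hS : FiniteDimensionalType S α β) (hSne : S.Nonempty)
    (hμ : ∀ᵐ x ∂μ, x ∈ closure S) (hΔ : 0 < Metric.diam S) {n : ℕ} (hn : n ≠ 0)
    {X : Fin n → Ω → E} (hX : ∀ i, HasLaw (X i) μ P) (hind : iIndepFun X P) {r : ℝ} (hr : 1 ≤ r)
    (K : ℕ) :
    eLpNorm (fun ω => wassersteinPow p μ (empiricalMeasure fun i => X i ω)) (ENNReal.ofReal r) P ≤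
      ENNReal.ofReal ((4 * Metric.diam S) ^ p *
        multiscaleBound α p (4 * √(max β 1) * 2 ^ (α / 2)) (r / n) K) := by
  have hp0 : 0 ≤ p := zero_le_one.trans hp
  have hr0 : 0 < r := one_pos.trans_le hr
  have hn' : (0 : ℝ) < n := Nat.cast_pos.2 (Nat.pos_of_ne_zero hn)
  have hr1 : 1 ≤ ENNReal.ofReal r := by simpa using hr
  have hemp : ∀ x : Fin n → E, IsProbabilityMeasure (empiricalMeasure x) :=
    isProbabilityMeasure_empiricalMeasure hn
  obtain ⟨C, hC0, hCne, hCT, hcov, hcard⟩ := hS.exists_nets hSne hΔ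
  set Δ := Metric.diam S
  obtain ⟨f, hf, hfC, hnest, hdist⟩ := exists_nested_nearest_maps C hCne hCT hcov K
  have hf0 : ∀ x y, f 0 x = f 0 y := fun x y => by
    obtain ⟨a, ha⟩ := Finset.card_eq_one.1 hC0
    have h1 := hfC 0 (Nat.zero_le K)
    simp only [ha, Finset.mem_singleton] at h1
    rw [h1 x, h1 y]
  -- Two points of a cell both lie within `2 Δ / 2 ^ k` of their common image.
  let D : ℕ → ℝ≥0∞ := fun k => ENNReal.ofReal (4 * (Δ / 2 ^ k))
  have hD : ∀ k ≤ K, ∀ x ∈ closure S, ∀ y ∈ closure S, f k x = f k y → edist x y ≤ D k := by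
    intro k hk x hx y hy hxy
    rw [edist_dist]
    refine ENNReal.ofReal_le_ofReal ?_
    have h1 := hdist k hk x hx
    have h2 := hdist k hk y hy
    have h3 := dist_triangle_left x y (f k x)
    have h4 : 0 < Δ / 2 ^ K := by positivity
    rw [← hxy] at h2
    linarith
  have hDp : ∀ k, D k ^ p = ENNReal.ofReal ((4 * Δ) ^ p * ((2 : ℝ) ^ (-p)) ^ k) := fun k => by
    rw [ENNReal.ofReal_rpow_of_pos (by positivity)]
    congr 1
    rw [Real.rpow_pow_comm two_pos.le, Real.rpow_neg (by positivity), ← mul_div_assoc,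
      Real.div_rpow (by positivity) (by positivity), div_eq_mul_inv]
  let T : ℕ → Ω → ℝ≥0∞ := fun k ω => ∑ c ∈ C (k + 1), (μ (f (k + 1) ⁻¹' {c}) -
    empiricalMeasure (fun i => X i ω) (f (k + 1) ⁻¹' {c}))
  have hTm : ∀ k ∈ Finset.range K, AEStronglyMeasurable (T k) P := fun k hk =>
    (aemeasurable_sum_tsub_empiricalMeasure hn μ (fun i => (hX i).aemeasurable) _
      (hf _ (Finset.mem_range.1 hk))).aestronglyMeasurable
  have hTle : ∀ k ∈ Finset.range K, eLpNorm (T k) (ENNReal.ofReal r) P ≤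
      ENNReal.ofReal (4 * √(max β 1) * 2 ^ (α / 2) * √(r / n) * ((2 : ℝ) ^ (α / 2)) ^ k) := by
    intro k hk
    -- The moment bound is used with `M = B * (2 ^ (k + 1)) ^ α * r`: `B ≥ 1` gives `M ≥ r`, and `r
    -- ≥ 1` gives `M ≥ card`. As a product, `M` has a square root that factors.
    set B := max β 1
    have hB : 1 ≤ B := le_max_right _ _
    have h2 : (1 : ℝ) ≤ ((2 : ℝ) ^ (k + 1)) ^ α :=
      Real.one_le_rpow (one_le_pow₀ one_le_two) hα.le
    have hBM : 1 ≤ B * ((2 : ℝ) ^ (k + 1)) ^ α := one_le_mul_of_one_le_of_one_le hB h2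
    have hM1 : r ≤ B * ((2 : ℝ) ^ (k + 1)) ^ α * r := le_mul_of_one_le_left hr0.le hBM
    have hM2 : ((C (k + 1)).card : ℝ) ≤ B * ((2 : ℝ) ^ (k + 1)) ^ α * r := by
      refine (hcard (k + 1) k.succ_pos).trans (max_le ?_ (by positivity))
      refine le_trans ?_ (le_mul_of_one_le_right (by positivity) hr)
      gcongr
      exact le_max_left _ _
    refine (eLpNorm_sum_tsub_empiricalMeasure_le hn hX hind (C (k + 1))
      (hf _ (Finset.mem_range.1 hk)) hr0 hM1 hM2).trans_eq ?_
    congr 1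
    have h3 : √(((2 : ℝ) ^ (k + 1)) ^ α) = 2 ^ (α / 2) * ((2 : ℝ) ^ (α / 2)) ^ k := by
      rw [Real.sqrt_eq_rpow, ← Real.rpow_mul (by positivity), ← pow_succ',
        ← Real.rpow_natCast, ← Real.rpow_natCast, ← Real.rpow_mul two_pos.le,
        ← Real.rpow_mul two_pos.le]
      ring_nf
    rw [mul_div_assoc, Real.sqrt_mul (by positivity), Real.sqrt_mul (by positivity), h3]
    ring
  have hW : ∀ᵐ ω ∂P, ‖wassersteinPow p μ (empiricalMeasure fun i => X i ω)‖ₑ ≤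
      ‖((fun _ => D K ^ p) + ∑ k ∈ Finset.range K, fun ω => D k ^ p * T k ω : Ω → ℝ≥0∞) ω‖ₑ := by
    filter_upwards [ae_empiricalMeasure_mem hX isClosed_closure.measurableSet hμ] with ω hω
    rw [enorm_eq_self, enorm_eq_self, Pi.add_apply, Finset.sum_apply]
    exact wassersteinPow_le_of_nested_partitions hp0 C f (closure S) D K hf hfC hnest hf0 hD μ _
      hμ hω
  have hDT : ∀ k ∈ Finset.range K, eLpNorm (fun ω => D k ^ p * T k ω) (ENNReal.ofReal r) P ≤
      D k ^ p * eLpNorm (T k) (ENNReal.ofReal r) P := fun k hk =>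
    eLpNorm_le_mul_eLpNorm_of_ae_le_mul'' _ (hTm k hk) (Filter.Eventually.of_forall fun ω => by
      rw [enorm_eq_self, enorm_eq_self])
  have hDTm : ∀ k ∈ Finset.range K, AEStronglyMeasurable (fun ω => D k ^ p * T k ω) P :=
    fun k hk => ((hTm k hk).aemeasurable.const_mul _).aestronglyMeasurable
  calc eLpNorm (fun ω => wassersteinPow p μ (empiricalMeasure fun i => X i ω))
        (ENNReal.ofReal r) P
      ≤ eLpNorm (fun _ : Ω => D K ^ p) (ENNReal.ofReal r) P +
          ∑ k ∈ Finset.range K, eLpNorm (fun ω => D k ^ p * T k ω) (ENNReal.ofReal r) P :=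
        (eLpNorm_mono_enorm_ae hW).trans <| (eLpNorm_add_le aestronglyMeasurable_const
          (Finset.aestronglyMeasurable_sum _ hDTm) hr1).trans
          (add_le_add le_rfl (eLpNorm_sum_le hDTm hr1))
    _ ≤ D K ^ p + ∑ k ∈ Finset.range K, D k ^ p * ENNReal.ofReal
          (4 * √(max β 1) * 2 ^ (α / 2) * √(r / n) * ((2 : ℝ) ^ (α / 2)) ^ k) := by
        gcongr with k hk
        · rw [eLpNorm_const _ (by simpa using hr0) (IsProbabilityMeasure.ne_zero P)]
          simp
        · exact (hDT k hk).trans (mul_le_mul_right (hTle k hk) _)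
    _ = _ := by
        simp_rw [hDp]
        simp_rw [← ENNReal.ofReal_mul (show 0 ≤ (4 * Δ) ^ p * ((2 : ℝ) ^ (-p)) ^ _ by positivity)]
        rw [← ENNReal.ofReal_sum_of_nonneg fun _ _ => by positivity,
          ← ENNReal.ofReal_add (by positivity) (Finset.sum_nonneg fun _ _ => by positivity)]
        congr 1
        unfold multiscaleBound
        rw [mul_add, Finset.mul_sum, Finset.mul_sum]
        congr 1
        refine Finset.sum_congr rfl fun k _ => ?_
        rw [sub_eq_neg_add, Real.rpow_add two_pos, mul_pow]
        ring

/-- This is the one-cell partition with `K = 0`. It covers `r > n` and zero diameter, where the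
multiscale bound is not used. -/
theorem eLpNorm_wassersteinPow_le_diam {E : Type*} [MetricSpace E]
    [MeasurableSpace E] [BorelSpace E] {Ω : Type*} [MeasurableSpace Ω] {P : Measure Ω}
    [IsProbabilityMeasure P] {μ : Measure E} [IsProbabilityMeasure μ] {S : Set E} {p : ℝ}
    (hp : 0 ≤ p) (hS : Bornology.IsBounded S)
    (hμ : ∀ᵐ x ∂μ, x ∈ closure S) {n : ℕ} (hn : n ≠ 0)
    {X : Fin n → Ω → E} (hX : ∀ i, HasLaw (X i) μ P) {r : ℝ} (hr : 0 < r) :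
    eLpNorm (fun ω => wassersteinPow p μ (empiricalMeasure fun i => X i ω)) (ENNReal.ofReal r) P ≤
      ENNReal.ofReal (Metric.diam S ^ p) := by
  have hemp : ∀ x : Fin n → E, IsProbabilityMeasure (empiricalMeasure x) :=
    isProbabilityMeasure_empiricalMeasure hn
  have hW : ∀ᵐ ω ∂P, ‖wassersteinPow p μ (empiricalMeasure fun i => X i ω)‖ₑ ≤
      ‖ENNReal.ofReal (Metric.diam S ^ p)‖ₑ := by
    filter_upwards [ae_empiricalMeasure_mem hX isClosed_closure.measurableSet hμ] with ω hω
    rw [enorm_eq_self, enorm_eq_self, ← ENNReal.ofReal_rpow_of_nonneg Metric.diam_nonneg hp]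
    refine (wassersteinPow_le_of_nested_partitions hp (fun _ => {()}) (fun _ _ => ()) (closure S)
      (fun _ => ENNReal.ofReal (Metric.diam S)) 0 (fun _ _ => measurable_const) (by simp)
      (by simp) (by simp) (fun _ _ x hx y hy _ => ?_) μ _ hμ hω).trans (by simp)
    rw [edist_dist, ← Metric.diam_closure]
    exact ENNReal.ofReal_le_ofReal (Metric.dist_le_diam_of_mem hS.closure hx hy)
  refine (eLpNorm_mono_enorm_ae hW).trans_eq ?_
  rw [eLpNorm_const _ (by simpa using hr) (IsProbabilityMeasure.ne_zero P)]
  simp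

/-- A rate for `multiscaleBound` that is at least `1` where `s ≥ 1` is a rate for the moments of
the transport cost. -/
theorem eLpNorm_wassersteinPow_le_of_rate {E : Type*} [MetricSpace E] [PolishSpace E]
    [MeasurableSpace E] [BorelSpace E] {Ω : Type*} [MeasurableSpace Ω] {P : Measure Ω}
    [IsProbabilityMeasure P] {μ : Measure E} [IsProbabilityMeasure μ] {S : Set E} {α β p : ℝ}
    (hα : 0 < α) (hp : 1 ≤ p) (hS : FiniteDimensionalType S α β) (hSne : S.Nonempty)
    (hμ : ∀ᵐ x ∂μ, x ∈ closure S) {n : ℕ} (hn : n ≠ 0)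
    {X : Fin n → Ω → E} (hX : ∀ i, HasLaw (X i) μ P) (hind : iIndepFun X P) {r : ℝ} (hr : 1 ≤ r)
    {c R A : ℝ} (hcA : 4 ^ p * c ≤ A) (hA : 1 ≤ A) (hR0 : 0 ≤ R) (hR : 1 < r / n → 1 ≤ R)
    (hK : r / n ≤ 1 →
      ∃ K, multiscaleBound α p (4 * √(max β 1) * 2 ^ (α / 2)) (r / n) K ≤ c * R) :
    eLpNorm (fun ω => wassersteinPow p μ (empiricalMeasure fun i => X i ω)) (ENNReal.ofReal r) P ≤
      ENNReal.ofReal (A * Metric.diam S ^ p * R) := by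
  have hp0 : 0 ≤ p := zero_le_one.trans hp
  have hr0 : 0 < r := one_pos.trans_le hr
  have hdiam : 0 ≤ Metric.diam S ^ p := Real.rpow_nonneg Metric.diam_nonneg p
  have htriv := eLpNorm_wassersteinPow_le_diam hp0 hS.1 hμ hn hX hr0
  rcases (Metric.diam_nonneg (s := S)).eq_or_lt with h0 | hΔ
  · refine htriv.trans (ENNReal.ofReal_le_ofReal ?_)
    rw [← h0, Real.zero_rpow (by linarith)]
    simp
  rcases lt_or_ge 1 (r / n) with hrn | hrn
  · refine htriv.trans (ENNReal.ofReal_le_ofReal ?_)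
    rw [mul_right_comm]
    exact le_mul_of_one_le_left hdiam (one_le_mul_of_one_le_of_one_le hA (hR hrn))
  · obtain ⟨K, hK⟩ := hK hrn
    refine (eLpNorm_wassersteinPow_le_multiscaleBound hα hp hS hSne hμ hΔ hn hX hind hr K).trans
      (ENNReal.ofReal_le_ofReal ?_)
    rw [Real.mul_rpow (by norm_num) Metric.diam_nonneg]
    calc 4 ^ p * Metric.diam S ^ p *
          multiscaleBound α p (4 * √(max β 1) * 2 ^ (α / 2)) (r / n) K
        ≤ 4 ^ p * Metric.diam S ^ p * (c * R) := by gcongr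
      _ = 4 ^ p * c * (Metric.diam S ^ p * R) := by ring
      _ ≤ A * (Metric.diam S ^ p * R) := by gcongr
      _ = A * Metric.diam S ^ p * R := by ring

theorem mainTheorem6 (α β p : ℝ) (hα : 0 < α) (hβ : 0 < β) (hp : 1 ≤ p) :
    ∃ C : ℝ, 0 < C ∧
      ∀ (E : Type u) [MetricSpace E] [PolishSpace E] [MeasurableSpace E] [BorelSpace E]
        (Ω : Type v) [MeasurableSpace Ω] (P : Measure Ω) [IsProbabilityMeasure P]
        (μ : Measure E) [IsProbabilityMeasure μ] (S : Set E),
        μ S = 1 → FiniteDimensionalType S α β →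
        ∀ (n : ℕ), 1 ≤ n → ∀ (X : Fin n → Ω → E),
          (∀ i, HasLaw (X i) μ P) → iIndepFun X P →
          AEMeasurable (fun ω => wassersteinPow p μ (empiricalMeasure fun i => X i ω)) P ∧
          ∀ r : ℝ, 2 ≤ r →
            (α < 2 * p →
              eLpNorm (fun ω => wassersteinPow p μ (empiricalMeasure fun i => X i ω))
                  (ENNReal.ofReal r) P ≤
                ENNReal.ofReal (C * Metric.diam S ^ p * √(r / n))) ∧
            (α = 2 * p →
              eLpNorm (fun ω => wassersteinPow p μ (empiricalMeasure fun i => X i ω))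
                  (ENNReal.ofReal r) P ≤
                ENNReal.ofReal
                  (C * Metric.diam S ^ p * (√(r / n) * Real.log (Real.exp 1 + n / r)))) ∧
            (2 * p < α →
              eLpNorm (fun ω => wassersteinPow p μ (empiricalMeasure fun i => X i ω))
                  (ENNReal.ofReal r) P ≤
                ENNReal.ofReal (C * Metric.diam S ^ p * (r / n) ^ (p / α))) := by
  set A : ℝ := 4 * √(max β 1) * 2 ^ (α / 2) with hAdef
  have hA : 0 ≤ A := by positivity
  -- Only one regime occurs for given `α` and `p`; the other two clauses are vacuous, so one `c`
  -- serves all.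
  obtain ⟨c, hc⟩ : ∃ c : ℝ,
      (α < 2 * p → ∀ s : ℝ, 0 < s → ∃ K, multiscaleBound α p A s K ≤ c * √s) ∧
      (α = 2 * p → ∀ s : ℝ, 0 < s → s ≤ 1 →
        ∃ K, multiscaleBound α p A s K ≤ c * (√s * Real.log (Real.exp 1 + s⁻¹))) ∧
      (2 * p < α → ∀ s : ℝ, 0 < s → s ≤ 1 →
        ∃ K, multiscaleBound α p A s K ≤ c * s ^ (p / α)) := by
    rcases lt_trichotomy α (2 * p) with h | h | h
    · obtain ⟨c, -, hc⟩ := exists_multiscaleBound_le_of_lt hp h hA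
      exact ⟨c, fun _ => hc, fun h' => absurd h' h.ne, fun h' => absurd h' h.not_gt⟩
    · obtain ⟨c, -, hc⟩ := exists_multiscaleBound_le_of_eq hp h hA
      exact ⟨c, fun h' => absurd h h'.ne, fun _ => hc, fun h' => absurd h h'.ne'⟩
    · obtain ⟨c, -, hc⟩ := exists_multiscaleBound_le_of_gt hα hp h hA
      exact ⟨c, fun h' => absurd h' h.not_gt, fun h' => absurd h' h.ne', fun _ => hc⟩
  obtain ⟨hc1, hc2, hc3⟩ := hc
  -- The factor `4 ^ p` comes from the cell diameters `4 Δ / 2 ^ k`, the `1` from the trivial bound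
  -- for `r > n`.
  refine ⟨max (4 ^ p * c) 1, by positivity, ?_⟩
  intro E _ _ _ _ Ω _ P _ μ _ S hμS hS n hn X hX hind
  have hn0 : n ≠ 0 := Nat.one_le_iff_ne_zero.1 hn
  have hn' : (0 : ℝ) < n := Nat.cast_pos.2 hn
  have hSne : S.Nonempty := by
    rw [Set.nonempty_iff_ne_empty]
    rintro rfl
    simp at hμS
  have hμ : ∀ᵐ x ∂μ, x ∈ closure S :=
    (prob_compl_eq_zero_iff isClosed_closure.measurableSet).2
      (le_antisymm prob_le_one (hμS ▸ measure_mono subset_closure))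
  refine ⟨?_, fun r hr => ?_⟩
  · obtain ⟨a, ha⟩ := hSne
    have hb : ∀ᵐ x ∂μ, edist x a ≤ ENNReal.ofReal (Metric.diam S) := by
      filter_upwards [hμ] with x hx
      rw [edist_dist, ← Metric.diam_closure]
      exact ENNReal.ofReal_le_ofReal
        (Metric.dist_le_diam_of_mem hS.1.closure hx (subset_closure ha))
    exact (measurable_wassersteinPow_empiricalMeasure (zero_le_one.trans hp) μ
      ENNReal.ofReal_ne_top hb).comp_aemeasurable
      (aemeasurable_pi_lambda _ fun i => (hX i).aemeasurable)
  have hr1 : 1 ≤ r := by linarith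
  have hs : 0 < r / n := by positivity
  have hinv : n / r = (r / n)⁻¹ := (inv_div _ _).symm
  have hL : 1 ≤ Real.log (Real.exp 1 + (r / n)⁻¹) := by
    rw [Real.le_log_iff_exp_le (by positivity)]
    linarith [inv_pos.2 hs]
  have key := fun (R : ℝ) => eLpNorm_wassersteinPow_le_of_rate (R := R) hα hp hS hSne hμ hn0 hX
    hind hr1 (le_max_left (4 ^ p * c) 1) (le_max_right (4 ^ p * c) 1)
  refine ⟨fun h => ?_, fun h => ?_, fun h => ?_⟩
  · exact key _ (Real.sqrt_nonneg _) (fun h1 => Real.one_le_sqrt.2 h1.le) fun _ => hc1 h _ hs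
  · rw [hinv]
    exact key _ (mul_nonneg (Real.sqrt_nonneg _) (zero_le_one.trans hL))
      (fun h1 => one_le_mul_of_one_le_of_one_le (Real.one_le_sqrt.2 h1.le) hL)
      fun h1 => hc2 h _ hs h1
  · exact key _ (Real.rpow_nonneg hs.le _)
      (fun h1 => Real.one_le_rpow h1.le (div_nonneg (zero_le_one.trans hp) hα.le))
      fun h1 => hc3 h _ hs h1
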